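/- There is no projective non-commuting graph. Precisely: let $G$ be a finite non-abelian group, and let its non-commuting graph $\Gamma'_G$ be the simple graph with vertex set $G\setminus Z(G)$ in which two vertices $x,y$ are adjacent if and only if $xy\neq yx$. Then $\Gamma'_G$ does not have crosscap exactly $1$; that is, it is not the case that $\Gamma'_G$ can be embedded in the real projective plane but cannot be embedded in the sphere. (An embedding of a graph in a surface is a drawing in which the vertices are distinct points, the edges are simple arcs joining their ends, and edges meet only at common ends.) -/

import Mathlib

/-- The non-commuting graph of a group `G`: its vertices are the non-central elements of `G`, and
two vertices are adjacent when they do not commute. -/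
def nonCommutingGraph (G : Type*) [Group G] :
    SimpleGraph {x : G // x ∉ Subgroup.center G} where
  Adj x y := x.1 * y.1 ≠ y.1 * x.1
  symm := ⟨fun _ _ h => h.symm⟩
  loopless := ⟨fun _ h => h rfl⟩

/-- An embedding (drawing without crossings) of a graph `Γ` in a topological space `X`: the vertices
are distinct points of `X`, every edge is a simple arc joining its two ends, the interior of an edge
contains no vertex, and the interiors of two different edges are disjoint. -/
structure GraphDrawing {V : Type*} (Γ : SimpleGraph V) (X : Type*) [TopologicalSpace X] where
  /-- the point that represents a vertex -/
  point : V → X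
  point_injective : Function.Injective point
  /-- the arc that represents an edge, parametrised from one end to the other -/
  arc : ∀ {u v : V}, Γ.Adj u v → Path (point u) (point v)
  /-- the two directions of an edge are drawn as the same arc -/
  arc_symm : ∀ {u v : V} (h : Γ.Adj u v), arc h.symm = (arc h).symm
  arc_injective : ∀ {u v : V} (h : Γ.Adj u v), Function.Injective (arc h)
  arc_ne_point : ∀ {u v : V} (h : Γ.Adj u v) (w : V) (t : unitInterval),
    t ≠ 0 → t ≠ 1 → arc h t ≠ point w
  arc_disjoint : ∀ {u v u' v' : V} (h : Γ.Adj u v) (h' : Γ.Adj u' v'), s(u, v) ≠ s(u', v') →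
    ∀ t t' : unitInterval, t ≠ 0 → t ≠ 1 → t' ≠ 0 → t' ≠ 1 → arc h t ≠ arc h' t'

/-- The graph `Γ` can be embedded in the space `X`. -/
def EmbedsIn {V : Type*} (Γ : SimpleGraph V) (X : Type*) [TopologicalSpace X] : Prop :=
  Nonempty (GraphDrawing Γ X)

/-- The unit sphere of three-dimensional Euclidean space. -/
abbrev TwoSphere : Type := Metric.sphere (0 : EuclideanSpace ℝ (Fin 3)) 1

/-- The antipodal relation on the sphere. -/
def antipodalSetoid : Setoid TwoSphere where
  r x y := x = y ∨ x = -y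
  iseqv :=
    { refl := fun _ => Or.inl rfl
      symm := by
        rintro x y (h | h)
        · exact Or.inl h.symm
        · exact Or.inr (by rw [h, neg_neg])
      trans := by
        rintro x y z (rfl | rfl) (rfl | rfl)
        · exact Or.inl rfl
        · exact Or.inr rfl
        · exact Or.inr rfl
        · exact Or.inl (neg_neg _) }

/-- The real projective plane: the sphere with antipodal points identified, with the quotient
topology. -/
abbrev ProjectivePlane : Type := Quotient antipodalSetoid

/-- A graph is projective (has crosscap exactly `1`) when it can be embedded in the projective plane
but not in the sphere. -/
def IsProjectiveGraph {V : Type*} (Γ : SimpleGraph V) : Prop :=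
  EmbedsIn Γ ProjectivePlane ∧ ¬ EmbedsIn Γ TwoSphere

/-! The order of `G` decides. If it is at least 10, the non-commuting graph contains K(3,5), which
has no drawing in the projective plane; if it is less than 10, the graph is planar.

For K(3,5), arcs are lifted along the antipodal double cover. With chosen points `a i`, `b j` above
the vertices, the lift of an edge from `a i` ends at `b j` or at its antipode, which gives a 3 × 5
table of signs. Pigeonhole on the columns and a majority vote on the rows yield a K(3,3) in which
eight of the nine edges have consistent lifts. The ninth is replaced by a detour through antipodal
lifts, and a point above a further vertex is the centre of a stereographic projection. This
contradicts `not_exists_disjoint_paths_plane`, a parity argument with winding numbers.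

For large groups, take a non-central `x` with `x * x ≠ 1`. The elements `x` and `x⁻¹` are distinct
with the same centralizer, so together with a suitable `y` they fail to commute with everything
outside two centralizers; counting leaves five such elements except when the centre of `C(x)`
supplies the three vertices itself. For small groups, the graph lies in K(5) minus an edge or in the
octahedron, and both have straight-line drawings. -/

/-! ### Winding numbers and K(3,3) in the plane -/

open scoped unitInterval in
theorem exists_log_of_ne_zero (f : C(I × I, ℂ)) (hf : ∀ x, f x ≠ 0) :
    ∃ g : C(I × I, ℂ), ∀ x, Complex.exp (g x) = f x := by
  have : ContractibleSpace I := (convex_Icc (0 : ℝ) 1).contractibleSpace ⟨0, by simp⟩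
  have : LocallyPathConnectedSpace I := (convex_Icc (0 : ℝ) 1).locallyPathConnectedSpace
  let f' : C(I × I, {z : ℂ // z ≠ 0}) := ⟨fun x => ⟨f x, hf x⟩, by fun_prop⟩
  obtain ⟨g, ⟨-, hg⟩, -⟩ := Complex.isCoveringMap_exp.existsUnique_continuousMap_lifts f'
    (a₀ := (0, 0)) (e₀ := Complex.log (f (0, 0))) (by
      ext
      exact Complex.exp_log (hf _))
  exact ⟨g, fun x => congrArg Subtype.val (congrFun hg x)⟩

-- Both sides are lifts through `exp` of the same path up to a constant factor, so by uniqueness of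
-- lifts the logarithms differ by a constant.
open scoped unitInterval in
theorem log_change_eq {g g' : C(I, ℂ)} {c : ℂ}
    (h : ∀ t, Complex.exp (g' t) = c * Complex.exp (g t)) : g' 1 - g' 0 = g 1 - g 0 := by
  have hc : c = Complex.exp (g' 0 - g 0) := by
    rw [Complex.exp_sub, h 0, mul_div_cancel_right₀ _ (Complex.exp_ne_zero _)]
  have key : (g' : I → ℂ) = fun t => g t + (g' 0 - g 0) := by
    refine Complex.isCoveringMap_exp.eq_of_comp_eq (by fun_prop) (by fun_prop) ?_ 0 (by ring)
    ext t
    change Complex.exp (g' t) = Complex.exp (g t + (g' 0 - g 0))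
    rw [h t, Complex.exp_add, hc, mul_comm]
  rw [congrFun key 1]
  ring

/-- The complete bipartite graph on three and three points has no drawing in the plane for which
edges without a common end are disjoint. -/
theorem not_exists_disjoint_paths_plane (a b : Fin 3 → ℂ) (P : ∀ i j, Path (a i) (b j))
    (disj : ∀ i j k l, i ≠ k → j ≠ l → ∀ s t, P i j s ≠ P k l t) : False := by
  open scoped unitInterval in
  have hG : ∀ i j k l, i ≠ k → j ≠ l →
      ∃ G : C(I × I, ℂ), ∀ s t, Complex.exp (G (s, t)) = P i j s - P k l t := by
    intro i j k l hik hjl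
    obtain ⟨G, h⟩ := exists_log_of_ne_zero
      ⟨fun x : I × I => P i j x.1 - P k l x.2, by fun_prop⟩
      (fun x => sub_ne_zero.2 (disj i j k l hik hjl x.1 x.2))
    exact ⟨G, fun s t => h (s, t)⟩
  have hother : ∀ j : Fin 3, ∃ j', j' ≠ j := by decide
  open scoped unitInterval in
  -- The logarithm is chosen for a vertex and an edge only, so that its change is the same number
  -- for every second edge at that vertex. The value 0 for `i = k` is a dummy.
  have hA : ∀ i k l, ∃ g : C(I, ℂ), i ≠ k → ∀ t, Complex.exp (g t) = a i - P k l t := by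
    intro i k l
    by_cases hik : i = k
    · exact ⟨0, fun h => absurd hik h⟩
    obtain ⟨j, hj⟩ := hother l
    obtain ⟨G, h⟩ := hG i j k l hik hj
    exact ⟨⟨fun t => G (0, t), by fun_prop⟩, fun _ t => by simpa using h 0 t⟩
  open scoped unitInterval in
  have hB : ∀ j k l, ∃ g : C(I, ℂ), j ≠ l → ∀ t, Complex.exp (g t) = b j - P k l t := by
    intro j k l
    by_cases hjl : j = l
    · exact ⟨0, fun h => absurd hjl h⟩
    obtain ⟨i, hi⟩ := hother k
    obtain ⟨G, h⟩ := hG i j k l hi hjl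
    exact ⟨⟨fun t => G (1, t), by fun_prop⟩, fun _ t => by simpa using h 1 t⟩
  choose gA hgA using hA
  choose gB hgB using hB
  -- A logarithm of `P i j s - P k l t` exists on the whole square, so its changes along the four
  -- sides add up to zero.
  have hrel : ∀ i j k l, i ≠ k → j ≠ l →
      (gA k i j 1 - gA k i j 0) + (gB j k l 1 - gB j k l 0) -
        (gB l i j 1 - gB l i j 0) - (gA i k l 1 - gA i k l 0) = 0 := by
    intro i j k l hik hjl
    obtain ⟨G, h⟩ := hG i j k l hik hjl
    have h1 := log_change_eq (g := gA k i j) (g' := ⟨fun s => G (s, 0), by fun_prop⟩) (c := -1)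
      (fun s => by simp [h s 0, hgA k i j hik.symm])
    have h2 := log_change_eq (g := gB l i j) (g' := ⟨fun s => G (s, 1), by fun_prop⟩) (c := -1)
      (fun s => by simp [h s 1, hgB l i j hjl.symm])
    have h3 := log_change_eq (g := gA i k l) (g' := ⟨fun s => G (0, s), by fun_prop⟩) (c := 1)
      (fun s => by simp [h 0 s, hgA i k l hik])
    have h4 := log_change_eq (g := gB j k l) (g' := ⟨fun s => G (1, s), by fun_prop⟩) (c := 1)
      (fun s => by simp [h 1 s, hgB j k l hjl])
    simp only [ContinuousMap.coe_mk] at h1 h2 h3 h4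
    rw [← h1, ← h2, ← h3, ← h4]
    ring
  have hab : ∀ i j, a i ≠ b j := by
    intro i j
    obtain ⟨k, hk⟩ := hother i
    obtain ⟨l, hl⟩ := hother j
    simpa using disj i l k j hk.symm hl 0 1
  have haa : ∀ i k, i ≠ k → a i ≠ a k := fun i k hik => by
    simpa using disj i 0 k 1 hik (by decide) 0 0
  have hbb : ∀ j l, j ≠ l → b j ≠ b l := fun j l hjl => by
    simpa using disj 0 j 1 l (by decide) hjl 1 1
  let Aab : Fin 3 → Fin 3 → ℂ := fun i j => Complex.log (a i - b j)
  -- Logarithms of differences within a class, normalised so that exchanging the two indices costs a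
  -- half turn. These half turns are the source of the parity.
  let D : (Fin 3 → ℂ) → Fin 3 → Fin 3 → ℂ := fun c i k =>
    if i < k then Complex.log (c i - c k) else Complex.log (c k - c i) + Real.pi * Complex.I
  have hAab : ∀ i j, Complex.exp (Aab i j) = a i - b j := fun i j =>
    Complex.exp_log (sub_ne_zero.2 (hab i j))
  have hD : ∀ c : Fin 3 → ℂ, (∀ i k, i ≠ k → c i ≠ c k) →
      ∀ i k, i ≠ k → Complex.exp (D c i k) = c i - c k := by
    intro c hc i k hik
    by_cases h : i < k
    · simp only [D, if_pos h]
      exact Complex.exp_log (sub_ne_zero.2 (hc i k hik))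
    · simp only [D, if_neg h]
      rw [Complex.exp_add, Complex.exp_log (sub_ne_zero.2 (hc k i hik.symm)), Complex.exp_pi_mul_I]
      ring
  have hDsymm : ∀ (c : Fin 3 → ℂ) (i k), i < k → D c k i = D c i k + Real.pi * Complex.I := by
    intro c i k h
    simp only [D, if_pos h, if_neg h.not_gt]
  have hnA : ∀ i k l, ∃ n : ℤ, i ≠ k → gA i k l 1 - gA i k l 0 =
      Aab i l - D a i k + n * (2 * Real.pi * Complex.I) := by
    intro i k l
    by_cases hik : i = k
    · exact ⟨0, fun h => absurd hik h⟩
    have : Complex.exp (gA i k l 1 - gA i k l 0) = Complex.exp (Aab i l - D a i k) := by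
      rw [Complex.exp_sub, Complex.exp_sub, hgA i k l hik, hgA i k l hik, hAab,
        hD a haa i k hik]
      simp
    obtain ⟨n, hn⟩ := Complex.exp_eq_exp_iff_exists_int.1 this
    exact ⟨n, fun _ => hn⟩
  have hnB : ∀ j k l, ∃ n : ℤ, j ≠ l → gB j k l 1 - gB j k l 0 =
      D b j l - (Aab k j + Real.pi * Complex.I) + n * (2 * Real.pi * Complex.I) := by
    intro j k l
    by_cases hjl : j = l
    · exact ⟨0, fun h => absurd hjl h⟩
    have : Complex.exp (gB j k l 1 - gB j k l 0) =
        Complex.exp (D b j l - (Aab k j + Real.pi * Complex.I)) := by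
      rw [Complex.exp_sub, Complex.exp_sub, hgB j k l hjl, hgB j k l hjl, Complex.exp_add, hAab,
        hD b hbb j l hjl, Complex.exp_pi_mul_I]
      simp
    obtain ⟨n, hn⟩ := Complex.exp_eq_exp_iff_exists_int.1 this
    exact ⟨n, fun _ => hn⟩
  choose nA hnA using hnA
  choose nB hnB using hnB
  have hpi : (2 * Real.pi * Complex.I : ℂ) ≠ 0 := Complex.two_pi_I_ne_zero
  -- The half turns from the two classes add to a full turn if the edges join the pairs in the same
  -- order, and cancel otherwise.
  have key : ∀ i k, i < k → ∀ j l, j < l →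
      (nA k i j + nB j k l - nB l i j - nA i k l = 1) ∧
      (nA k i l + nB l k j - nB j i l - nA i k j = 0) := by
    intro i k hik j l hjl
    have h1 := hrel i j k l hik.ne hjl.ne
    have h2 := hrel i l k j hik.ne hjl.ne'
    rw [hnA k i _ hik.ne', hnA i k _ hik.ne, hnB _ _ _ hjl.ne, hnB _ _ _ hjl.ne',
      hDsymm a i k hik, hDsymm b j l hjl] at h1 h2
    constructor
    · have : ((nA k i j + nB j k l - nB l i j - nA i k l - 1 : ℤ) : ℂ) *
          (2 * Real.pi * Complex.I) = 0 := by
        push_cast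
        linear_combination h1
      have := (mul_eq_zero.1 this).resolve_right hpi
      have := Int.cast_eq_zero.1 this
      omega
    · have : ((nA k i l + nB l k j - nB j i l - nA i k j : ℤ) : ℂ) *
          (2 * Real.pi * Complex.I) = 0 := by
        push_cast
        linear_combination h2
      exact Int.cast_eq_zero.1 ((mul_eq_zero.1 this).resolve_right hpi)
  -- Each unknown belongs to a vertex and an edge and occurs in exactly two of the 18 equations,
  -- with coefficients ±1. The sum of all left sides is therefore even, while the right sides add up
  -- to 9.
  have h01 := key 0 1 (by decide)
  have h02 := key 0 2 (by decide)
  have h12 := key 1 2 (by decide)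
  have e1 := h01 0 1 (by decide)
  have e2 := h01 0 2 (by decide)
  have e3 := h01 1 2 (by decide)
  have e4 := h02 0 1 (by decide)
  have e5 := h02 0 2 (by decide)
  have e6 := h02 1 2 (by decide)
  have e7 := h12 0 1 (by decide)
  have e8 := h12 0 2 (by decide)
  have e9 := h12 1 2 (by decide)
  omega

/-- Stereographic projection from `o` reduces this to the plane. The paths need not be simple, and
paths with a common end may meet; the detour in `not_forall_exists_isLift` needs this freedom. -/
theorem not_exists_disjoint_paths_sphere (o : TwoSphere) (a b : Fin 3 → TwoSphere)
    (P : ∀ i j, Path (a i) (b j))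
    (disj : ∀ i j k l, i ≠ k → j ≠ l → ∀ s t, P i j s ≠ P k l t)
    (ho : ∀ i j t, P i j t ≠ o) : False := by
  have : Fact (Module.finrank ℝ (EuclideanSpace ℝ (Fin 3)) = 2 + 1) := ⟨by simp⟩
  let φ := stereographic' 2 o
  have hs : ∀ i j, Set.range (P i j) ⊆ φ.source := by
    rintro i j _ ⟨t, rfl⟩
    simpa [φ] using ho i j t
  let f : TwoSphere → ℂ := fun x => Complex.orthonormalBasisOneI.repr.symm (φ x)
  have hf : ∀ i j, ContinuousOn f (Set.range (P i j)) := fun i j =>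
    Complex.orthonormalBasisOneI.repr.symm.continuous.comp_continuousOn (φ.continuousOn.mono (hs i j))
  refine not_exists_disjoint_paths_plane (f ∘ a) (f ∘ b) (fun i j => (P i j).map' (hf i j)) ?_
  intro i j k l hik hjl s t h
  refine disj i j k l hik hjl s t (φ.injOn (hs i j ⟨s, rfl⟩) (hs k l ⟨t, rfl⟩) ?_)
  exact Complex.orthonormalBasisOneI.repr.symm.injective h

/-! ### The double cover of the projective plane -/

/-- The covering projection from the sphere to the projective plane. -/
def ProjectivePlane.mk (p : TwoSphere) : ProjectivePlane := Quotient.mk antipodalSetoid p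

theorem ProjectivePlane.mk_eq_mk {p q : TwoSphere} :
    ProjectivePlane.mk p = ProjectivePlane.mk q ↔ p = q ∨ p = -q :=
  Quotient.eq (r := antipodalSetoid)

theorem ProjectivePlane.mk_neg (p : TwoSphere) :
    ProjectivePlane.mk (-p) = ProjectivePlane.mk p :=
  ProjectivePlane.mk_eq_mk.2 (Or.inr rfl)

theorem ProjectivePlane.mk_surjective : Function.Surjective ProjectivePlane.mk :=
  Quotient.mk_surjective

theorem TwoSphere.dist_neg_self (p : TwoSphere) : dist (-p) p = 2 := by
  have hp : ‖(p : EuclideanSpace ℝ (Fin 3))‖ = 1 := by simp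
  rw [Subtype.dist_eq, dist_eq_norm, coe_neg_sphere, ← neg_add', norm_neg, ← two_smul ℝ,
    norm_smul, hp]
  norm_num

theorem TwoSphere.neg_ne_self (p : TwoSphere) : -p ≠ p := fun h => by
  simpa [h] using TwoSphere.dist_neg_self p

/-- The group of order two acts by the antipodal map; antipodes are at distance 2, so a ball of
radius 1 is disjoint from its image. -/
theorem ProjectivePlane.isCoveringMap_mk : IsCoveringMap ProjectivePlane.mk := by
  let _ : MulAction ℤˣ TwoSphere :=
    { smul := fun u p => if u = 1 then p else -p
      one_smul := fun p => if_pos rfl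
      mul_smul := by
        intro u v p
        change (if u * v = 1 then p else -p) =
          if u = 1 then (if v = 1 then p else -p) else -(if v = 1 then p else -p)
        rcases Int.units_eq_one_or u with rfl | rfl <;>
          rcases Int.units_eq_one_or v with rfl | rfl <;> simp }
  have h1 : ∀ p : TwoSphere, (1 : ℤˣ) • p = p := fun p => if_pos rfl
  have hneg : ∀ p : TwoSphere, (-1 : ℤˣ) • p = -p := fun p => if_neg (by decide)
  suffices h : IsQuotientCoveringMap ProjectivePlane.mk ℤˣ from h.isCoveringMap
  have hquot : Topology.IsQuotientMap ProjectivePlane.mk :=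
    isQuotientMap_quotient_mk' (s := antipodalSetoid)
  have hcont : ContinuousConstSMul ℤˣ TwoSphere := by
    constructor
    intro u
    rcases Int.units_eq_one_or u with rfl | rfl
    · simp_rw [h1]; exact continuous_id
    · simp_rw [hneg]; exact continuous_neg
  refine { hquot, hcont with apply_eq_iff_mem_orbit := ?_, disjoint := ?_ }
  · intro p q
    rw [ProjectivePlane.mk_eq_mk, MulAction.mem_orbit_iff]
    constructor
    · rintro (h | h)
      · exact ⟨1, by rw [h1, h]⟩
      · exact ⟨-1, by rw [hneg, h]⟩
    · rintro ⟨u, rfl⟩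
      rcases Int.units_eq_one_or u with rfl | rfl
      · exact Or.inl (h1 q)
      · exact Or.inr (hneg q)
  · intro p
    refine ⟨Metric.ball p 1, Metric.ball_mem_nhds p one_pos, ?_⟩
    rintro u ⟨_, ⟨q, hq, rfl⟩, hq'⟩
    rcases Int.units_eq_one_or u with rfl | rfl
    · rfl
    · exfalso
      simp only [hneg, Metric.mem_ball] at hq hq'
      have h := dist_triangle_right (-q) q p
      rw [TwoSphere.dist_neg_self] at h
      linarith

/-! ### Lifting bipartite drawings to the sphere -/

/-- A drawing of the complete bipartite graph on `Fin m` and `Fin n` in the projective plane, with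
every edge parametrised from its end in `Fin m` to its end in `Fin n`. -/
structure BipartiteDrawing (m n : ℕ) (X : Type*) [TopologicalSpace X] where
  /-- the points of the first class -/
  left : Fin m → X
  /-- the points of the second class -/
  right : Fin n → X
  /-- the edges -/
  arc : ∀ i j, Path (left i) (right j)
  left_injective : Function.Injective left
  right_injective : Function.Injective right
  left_ne_right : ∀ i j, left i ≠ right j
  arc_ne_left : ∀ i j k t, arc i j t = left k → t = 0
  arc_ne_right : ∀ i j k t, arc i j t = right k → t = 1
  arc_disjoint : ∀ i j k l s t, arc i j s = arc k l t → s ≠ 0 → s ≠ 1 → i = k ∧ j = l ∧ s = t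

namespace BipartiteDrawing

variable {m n : ℕ} (D : BipartiteDrawing m n ProjectivePlane)

/-- The points `p` and `q` of the sphere are joined by a lift of the arc from the `i`-th point on
the left to the `j`-th point on the right. -/
def IsLift (i : Fin m) (j : Fin n) {p q : TwoSphere} (L : Path p q) : Prop :=
  ∀ t, ProjectivePlane.mk (L t) = D.arc i j t

variable {D}

theorem IsLift.mk_target {i j} {p q : TwoSphere} {L : Path p q} (h : D.IsLift i j L) :
    ProjectivePlane.mk q = D.right j := by simpa using h 1

theorem exists_isLift {i j} {p : TwoSphere} (hp : ProjectivePlane.mk p = D.left i) :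
    ∃ (q : TwoSphere) (L : Path p q), D.IsLift i j L := by
  have h0 : (D.arc i j : C(unitInterval, ProjectivePlane)) 0 = ProjectivePlane.mk p := by simp [hp]
  let Γ := ProjectivePlane.isCoveringMap_mk.liftPath (D.arc i j) p h0
  refine ⟨Γ 1, ⟨Γ, ProjectivePlane.isCoveringMap_mk.liftPath_zero _ _ h0, rfl⟩, fun t => ?_⟩
  exact congrFun (ProjectivePlane.isCoveringMap_mk.liftPath_lifts _ _ h0) t

theorem IsLift.neg {i j} {p q : TwoSphere} {L : Path p q} (h : D.IsLift i j L) :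
    D.IsLift i j (L.map (continuous_neg (G := TwoSphere))) := fun t =>
  (ProjectivePlane.mk_neg _).trans (h t)

/-- Two lifts of arcs with different sources and different targets are disjoint. -/
theorem IsLift.ne {i j k l} {p q p' q' : TwoSphere} {L : Path p q} {L' : Path p' q'}
    (h : D.IsLift i j L) (h' : D.IsLift k l L') (hp : p ≠ p') (hq : q ≠ q') (s t : unitInterval) :
    L s ≠ L' t := by
  intro hst
  have hd : D.arc i j s = D.arc k l t := by rw [← h, ← h', hst]
  by_cases hs0 : s = 0
  · subst hs0
    have ht : t = 0 := D.arc_ne_left k l i t (by rw [← hd]; simp)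
    subst ht
    exact hp (by simpa using hst)
  by_cases hs1 : s = 1
  · subst hs1
    have ht : t = 1 := D.arc_ne_right k l j t (by rw [← hd]; simp)
    subst ht
    exact hq (by simpa using hst)
  obtain ⟨rfl, rfl, rfl⟩ := D.arc_disjoint i j k l s t hd hs0 hs1
  -- Now both paths lift the same arc and agree at one parameter, so they coincide, against `p ≠
  -- p'`.
  have hL : (L : unitInterval → TwoSphere) = L' :=
    ProjectivePlane.isCoveringMap_mk.eq_of_comp_eq L.continuous L'.continuous
      (funext fun u => (h u).trans (h' u).symm) s hst
  exact hp (by simpa using congrFun hL 0)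

theorem IsLift.apply_ne {i j k} {p q o : TwoSphere} {L : Path p q} (h : D.IsLift i j L)
    (ho : ProjectivePlane.mk o = D.right k) (hjk : j ≠ k) (t : unitInterval) : L t ≠ o := by
  rintro rfl
  rw [h t] at ho
  have ht := D.arc_ne_right i j k t ho
  subst ht
  exact hjk (D.right_injective (by simpa using ho))

end BipartiteDrawing

namespace BipartiteDrawing

variable {m n : ℕ} {D : BipartiteDrawing m n ProjectivePlane}

/-- Lifts of all edges of a complete bipartite graph on three and three points but one cannot have
consistent ends. -/
theorem not_forall_exists_isLift {τ : Fin 3 → Fin m} {σ : Fin 3 → Fin n} {k : Fin n}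
    (hτ : Function.Injective τ) (hσ : Function.Injective σ) (hk : ∀ j, σ j ≠ k)
    {a b : Fin 3 → TwoSphere} (ha : ∀ i, ProjectivePlane.mk (a i) = D.left (τ i))
    (hb : ∀ j, ProjectivePlane.mk (b j) = D.right (σ j)) :
    ¬ ∀ i j, ¬ (i = 2 ∧ j = 2) → ∃ L : Path (a i) (b j), D.IsLift (τ i) (σ j) L := by
  intro h
  obtain ⟨o, ho⟩ := ProjectivePlane.mk_surjective (D.right k)
  have haa : ∀ i l, i ≠ l → a i ≠ a l ∧ -a i ≠ a l := fun i l hil =>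
    ⟨fun e => hil (hτ (D.left_injective (by rw [← ha, ← ha, e]))),
      fun e => hil (hτ (D.left_injective (by rw [← ha, ← ha, ← e, ProjectivePlane.mk_neg])))⟩
  have hbb : ∀ i l, i ≠ l → b i ≠ b l ∧ -b i ≠ b l := fun i l hil =>
    ⟨fun e => hil (hσ (D.right_injective (by rw [← hb, ← hb, e]))),
      fun e => hil (hσ (D.right_injective (by rw [← hb, ← hb, ← e, ProjectivePlane.mk_neg])))⟩
  -- Ends permitted for the lifts that make up the path `(i, j)`. The path `(2, 2)` may use any lift
  -- whose ends avoid `a 0`, `a 1`, `b 0`, `b 1`; by `IsLift.ne` such a lift misses the edges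
  -- disjoint from `(2, 2)`.
  let allowed : Fin 3 → Fin 3 → TwoSphere → TwoSphere → Prop := fun i j p q =>
    (p = a i ∧ q = b j) ∨ (i = 2 ∧ j = 2 ∧ (p ≠ a 0 ∧ p ≠ a 1) ∧ (q ≠ b 0 ∧ q ≠ b 1))
  let cov : Fin 3 → Fin 3 → Set TwoSphere := fun i j => {x | ∃ (i' j' : Fin 3) (p q : TwoSphere)
    (M : Path p q), D.IsLift (τ i') (σ j') M ∧ allowed i j p q ∧ x ∈ Set.range M}
  have hallowed : ∀ i j k l p q p' q', i ≠ k → j ≠ l → allowed i j p q → allowed k l p' q' →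
      p ≠ p' ∧ q ≠ q' := by
    rintro i j k l p q p' q' hik hjl (⟨rfl, rfl⟩ | ⟨rfl, rfl, hp, hq⟩)
      (⟨rfl, rfl⟩ | ⟨rfl, rfl, hp', hq'⟩)
    · exact ⟨(haa _ _ hik).1, (hbb _ _ hjl).1⟩
    · have hi : i = 0 ∨ i = 1 := by omega
      have hj : j = 0 ∨ j = 1 := by omega
      constructor
      · rcases hi with rfl | rfl
        exacts [hp'.1.symm, hp'.2.symm]
      · rcases hj with rfl | rfl
        exacts [hq'.1.symm, hq'.2.symm]
    · have hi : k = 0 ∨ k = 1 := by omega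
      have hj : l = 0 ∨ l = 1 := by omega
      constructor
      · rcases hi with rfl | rfl
        exacts [hp.1, hp.2]
      · rcases hj with rfl | rfl
        exacts [hq.1, hq.2]
    · exact absurd rfl hik
  have hpath : ∀ i j, ∃ L : Path (a i) (b j), Set.range L ⊆ cov i j := by
    intro i j
    by_cases hij : i = 2 ∧ j = 2
    · obtain ⟨rfl, rfl⟩ := hij
      obtain ⟨q, Q, hQ⟩ := exists_isLift (j := σ 2) (ha 2)
      rcases ProjectivePlane.mk_eq_mk.1 (hQ.mk_target.trans (hb 2).symm) with rfl | rfl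
      · exact ⟨Q, fun x hx => ⟨2, 2, _, _, Q, hQ, Or.inl ⟨rfl, rfl⟩, hx⟩⟩
      · obtain ⟨P02, h02⟩ := h 0 2 (by decide)
        obtain ⟨P00, h00⟩ := h 0 0 (by decide)
        obtain ⟨P20, h20⟩ := h 2 0 (by decide)
        have n02 := h02.neg
        have n00 := h00.neg
        have n20 := h20.neg
        have nQ := hQ.neg
        have a2 : a 2 ≠ a 0 ∧ a 2 ≠ a 1 := ⟨(haa _ _ (by decide)).1, (haa _ _ (by decide)).1⟩
        have na2 : -a 2 ≠ a 0 ∧ -a 2 ≠ a 1 := ⟨(haa _ _ (by decide)).2, (haa _ _ (by decide)).2⟩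
        have na0 : -a 0 ≠ a 0 ∧ -a 0 ≠ a 1 := ⟨TwoSphere.neg_ne_self _, (haa _ _ (by decide)).2⟩
        have b2 : b 2 ≠ b 0 ∧ b 2 ≠ b 1 := ⟨(hbb _ _ (by decide)).1, (hbb _ _ (by decide)).1⟩
        have nb2 : -b 2 ≠ b 0 ∧ -b 2 ≠ b 1 := ⟨(hbb _ _ (by decide)).2, (hbb _ _ (by decide)).2⟩
        have nb0 : -b 0 ≠ b 0 ∧ -b 0 ≠ b 1 := ⟨TwoSphere.neg_ne_self _, (hbb _ _ (by decide)).2⟩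
        -- The lift `Q` ends at `-b 2`. The detour runs `a 2`, `-b 2`, `-a 0`, `-b 0`, `-a 2`, `b
        -- 2`, along `Q`, antipodes of three consistent edges, and the antipode of `Q`.
        refine ⟨(Q.trans ((P02.map continuous_neg).symm.trans ((P00.map continuous_neg).trans
          ((P20.map continuous_neg).symm.trans
            ((Q.map continuous_neg).cast rfl (neg_neg _).symm))))), ?_⟩
        simp only [Path.trans_range, Path.symm_range, Set.union_subset_iff, Path.cast_coe]
        refine ⟨?_, ?_, ?_, ?_, ?_⟩
        · exact fun x hx => ⟨_, _, _, _, Q, hQ, Or.inr ⟨rfl, rfl, a2, nb2⟩, hx⟩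
        · exact fun x hx => ⟨_, _, _, _, _, n02, Or.inr ⟨rfl, rfl, na0, nb2⟩, hx⟩
        · exact fun x hx => ⟨_, _, _, _, _, n00, Or.inr ⟨rfl, rfl, na0, nb0⟩, hx⟩
        · exact fun x hx => ⟨_, _, _, _, _, n20, Or.inr ⟨rfl, rfl, na2, nb0⟩, hx⟩
        · exact fun x hx => ⟨_, _, _, _, _, nQ, Or.inr ⟨rfl, rfl, na2, by rwa [neg_neg]⟩, hx⟩
    · obtain ⟨L, hL⟩ := h i j hij
      exact ⟨L, fun x hx => ⟨i, j, _, _, L, hL, Or.inl ⟨rfl, rfl⟩, hx⟩⟩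
  choose P hP using hpath
  refine not_exists_disjoint_paths_sphere o a b P ?_ ?_
  · intro i j k l hik hjl s t hst
    obtain ⟨i', j', p, q, M, hM, hpq, s', hs'⟩ := hP i j ⟨s, rfl⟩
    obtain ⟨k', l', p', q', M', hM', hpq', t', ht'⟩ := hP k l ⟨t, rfl⟩
    obtain ⟨hp, hq⟩ := hallowed i j k l p q p' q' hik hjl hpq hpq'
    exact hM.ne hM' hp hq s' t' (by rw [hs', ht', hst])
  · intro i j t
    obtain ⟨i', j', p, q, M, hM, -, s', hs'⟩ := hP i j ⟨t, rfl⟩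
    rw [← hs']
    exact hM.apply_ne ho (hk j') s'

end BipartiteDrawing

/-! ### Signs of lifted edges and K(3,5) -/

/-- `p` or its antipode, according to a sign. -/
noncomputable def TwoSphere.signed (e : Bool) (p : TwoSphere) : TwoSphere := if e then -p else p

theorem TwoSphere.signed_signed (e e' : Bool) (p : TwoSphere) :
    signed e (signed e' p) = signed (e ^^ e') p := by
  cases e <;> cases e' <;> simp [signed]

theorem ProjectivePlane.mk_signed (e : Bool) (p : TwoSphere) : mk (TwoSphere.signed e p) = mk p := by
  cases e <;> simp [TwoSphere.signed, mk_neg]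

/-- The complete bipartite graph on three and five points has no drawing in the projective plane. -/
theorem isEmpty_bipartiteDrawing_three_five :
    IsEmpty (BipartiteDrawing 3 5 ProjectivePlane) := by
  constructor
  intro D
  choose a ha using fun i => ProjectivePlane.mk_surjective (D.left i)
  choose b hb using fun j => ProjectivePlane.mk_surjective (D.right j)
  let J : Fin 3 → Fin 5 → TwoSphere → TwoSphere → Prop := fun i j p q =>
    ∃ L : Path p q, D.IsLift i j L
  have Jsigned : ∀ i j p q e, J i j p q → J i j (.signed e p) (.signed e q) := by
    rintro i j p q (_ | _) ⟨L, hL⟩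
    exacts [⟨L, hL⟩, ⟨_, hL.neg⟩]
  have hsign : ∀ i j, ∃ e, J i j (a i) (.signed e (b j)) := by
    intro i j
    obtain ⟨q, L, hL⟩ := BipartiteDrawing.exists_isLift (j := j) (ha i)
    rcases ProjectivePlane.mk_eq_mk.1 (hL.mk_target.trans (hb j).symm) with rfl | rfl
    exacts [⟨false, L, hL⟩, ⟨true, L, hL⟩]
  choose s hs using hsign
  -- The pair records a column of signs up to a global flip: four values for five columns.
  obtain ⟨j, j', hjj', hf⟩ := Fintype.exists_ne_map_eq_of_card_lt
    (fun j => (s 0 j ^^ s 1 j, s 0 j ^^ s 2 j)) (by simp)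
  simp only [Prod.mk.injEq] at hf
  have hconst : ∀ i, (s i j ^^ s i j') = (s 0 j ^^ s 0 j') := by
    have hxor : ∀ x y z w : Bool, (x ^^ y) = (z ^^ w) → (y ^^ w) = (x ^^ z) := by decide
    intro i
    fin_cases i
    exacts [rfl, hxor _ _ _ _ hf.1, hxor _ _ _ _ hf.2]
  have hthird : ∀ j j' : Fin 5, ∃ k l, k ≠ j ∧ k ≠ j' ∧ l ≠ j ∧ l ≠ j' ∧ l ≠ k := by decide
  obtain ⟨k, l, hkj, hkj', hlj, hlj', hlk⟩ := hthird j j'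
  have hmajority : ∀ t : Fin 3 → Bool, ∃ i₀ e, ∀ i, i ≠ i₀ → t i = e := by decide
  obtain ⟨i₀, e, he⟩ := hmajority fun i => s i j ^^ s i k
  -- Replacing `a i` by its antipode where `s i j` is set makes column `j` trivial and column `j'`
  -- constant.
  have hJ : ∀ i j', J i j' (.signed (s i j) (a i)) (.signed (s i j ^^ s i j') (b j')) := by
    intro i j'
    rw [← TwoSphere.signed_signed]
    exact Jsigned _ _ _ _ _ (hs i j')
  -- The row outvoted in column `k` is moved to position 2, so that only the edge `(2, 2)` can be
  -- inconsistent.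
  let τ := Equiv.swap i₀ 2
  refine BipartiteDrawing.not_forall_exists_isLift (D := D) (τ := τ) (σ := ![j, j', k]) (k := l)
    (a := fun i => .signed (s (τ i) j) (a (τ i)))
    (b := ![b j, .signed (s 0 j ^^ s 0 j') (b j'), .signed e (b k)]) τ.injective ?_ ?_ ?_ ?_ ?_
  · intro x y hxy
    fin_cases x <;> fin_cases y <;> simp_all
  · intro x
    fin_cases x
    exacts [hlj.symm, hlj'.symm, hlk.symm]
  · intro i
    rw [ProjectivePlane.mk_signed, ha]
  · intro x
    fin_cases x <;> simp [ProjectivePlane.mk_signed, hb]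
  · intro i x hix
    fin_cases x
    · simpa [TwoSphere.signed] using hJ (τ i) j
    · simpa [hconst] using hJ (τ i) j'
    · have hi : τ i ≠ i₀ := by
        intro h
        refine hix ⟨?_, rfl⟩
        rw [← τ.injective.eq_iff, h]
        simp [τ]
      simpa [he _ hi] using hJ (τ i) k

/-- A drawing of a graph restricts to a drawing of a complete bipartite subgraph. -/
def GraphDrawing.toBipartiteDrawing {V X : Type*} [TopologicalSpace X] {Γ : SimpleGraph V}
    (D : GraphDrawing Γ X) {m n : ℕ} {f : Fin m → V} {g : Fin n → V} (hf : Function.Injective f)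
    (hg : Function.Injective g) (hfg : ∀ i j, Γ.Adj (f i) (g j)) : BipartiteDrawing m n X where
  left i := D.point (f i)
  right j := D.point (g j)
  arc i j := D.arc (hfg i j)
  left_injective := D.point_injective.comp hf
  right_injective := D.point_injective.comp hg
  left_ne_right i j h := (hfg i j).ne (D.point_injective h)
  arc_ne_left i j k t h := by
    by_contra h0
    by_cases h1 : t = 1
    · subst h1
      exact (hfg k j).ne' (D.point_injective (by simpa using h))
    · exact D.arc_ne_point (hfg i j) (f k) t h0 h1 h
  arc_ne_right i j k t h := by
    by_contra h1
    by_cases h0 : t = 0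
    · subst h0
      exact (hfg i k).ne (D.point_injective (by simpa using h))
    · exact D.arc_ne_point (hfg i j) (g k) t h0 h1 h
  arc_disjoint i j k l s t h h0 h1 := by
    have ht0 : t ≠ 0 := by
      rintro rfl
      exact D.arc_ne_point (hfg i j) (f k) s h0 h1 (by simpa using h)
    have ht1 : t ≠ 1 := by
      rintro rfl
      exact D.arc_ne_point (hfg i j) (g l) s h0 h1 (by simpa using h)
    by_cases he : s(f i, g j) = s(f k, g l)
    · rcases Sym2.eq_iff.1 he with ⟨hi, hj⟩ | ⟨hi, -⟩
      · obtain rfl := hf hi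
        obtain rfl := hg hj
        exact ⟨rfl, rfl, D.arc_injective _ h⟩
      · exact absurd hi (hfg i l).ne
    · exact absurd h (D.arc_disjoint (hfg i j) (hfg k l) he s t h0 h1 ht0 ht1)

/-- A graph that contains a complete bipartite graph on three and five vertices has no drawing in
the projective plane. -/
theorem not_embedsIn_projectivePlane {V : Type*} {Γ : SimpleGraph V} {f : Fin 3 → V}
    {g : Fin 5 → V} (hf : Function.Injective f) (hg : Function.Injective g)
    (hfg : ∀ i j, Γ.Adj (f i) (g j)) : ¬ EmbedsIn Γ ProjectivePlane := fun ⟨D⟩ =>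
  isEmpty_bipartiteDrawing_three_five.false (D.toBipartiteDrawing hf hg hfg)

/-! ### K(3,5) in groups of order at least ten -/

section Group

variable {G : Type*} [Group G]

/-- Otherwise a central `z` and the non-central `a`, `z * a` give `z * z = 1` too, and a group of
exponent two is abelian. -/
theorem exists_notMem_center_mul_self_ne_one {a b : G} (hab : a * b ≠ b * a) :
    ∃ x : G, x ∉ Subgroup.center G ∧ x * x ≠ 1 := by
  by_contra! h
  have ha : a ∉ Subgroup.center G := fun h => hab (Subgroup.mem_center_iff.1 h b).symm
  have hsq : ∀ z : G, z * z = 1 := by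
    intro z
    by_cases hz : z ∈ Subgroup.center G
    · have hza : z * a ∉ Subgroup.center G := fun h' =>
        ha ((Subgroup.mul_mem_cancel_left _ hz).1 h')
      have h1 := h _ hza
      rw [mul_assoc, ← mul_assoc a, Subgroup.mem_center_iff.1 hz a, mul_assoc z, h a ha,
        mul_one] at h1
      exact h1
    · exact h z hz
  have hinv : ∀ z : G, z⁻¹ = z := fun z => inv_eq_of_mul_eq_one_left (hsq z)
  apply hab
  rw [← hinv (a * b), mul_inv_rev, hinv, hinv]

/-- The complete bipartite graph on three and five vertices is a subgraph of the non-commuting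
graph. -/
def HasNonCommutingThreeFive (G : Type*) [Group G] : Prop :=
  ∃ (f : Fin 3 → G) (g : Fin 5 → G), Function.Injective f ∧ Function.Injective g ∧
    ∀ i j, f i * g j ≠ g j * f i

theorem HasNonCommutingThreeFive.not_embedsIn (h : HasNonCommutingThreeFive G) :
    ¬ EmbedsIn (nonCommutingGraph G) ProjectivePlane := by
  obtain ⟨f, g, hf, hg, hfg⟩ := h
  have hf' : ∀ i, f i ∉ Subgroup.center G := fun i h =>
    hfg i 0 (Subgroup.mem_center_iff.1 h _).symm
  have hg' : ∀ j, g j ∉ Subgroup.center G := fun j h =>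
    hfg 0 j (Subgroup.mem_center_iff.1 h _)
  exact not_embedsIn_projectivePlane (f := fun i => ⟨f i, hf' i⟩) (g := fun j => ⟨g j, hg' j⟩)
    (fun i i' h => hf (congrArg Subtype.val h)) (fun j j' h => hg (congrArg Subtype.val h)) hfg

theorem mem_centralizer_singleton {x g : G} : g ∈ Subgroup.centralizer {x} ↔ g * x = x * g :=
  Subgroup.mem_centralizer_singleton_iff

theorem ncard_coe_subgroup (H : Subgroup G) : (H : Set G).ncard = Nat.card H := rfl

variable [Finite G]

theorem hasNonCommutingThreeFive_of_ncard {x y z : G} (hxy : x ≠ y) (hxz : x ≠ z) (hyz : y ≠ z)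
    {S : Set G} (hS : 5 ≤ S.ncard)
    (h : ∀ g ∈ S, x * g ≠ g * x ∧ y * g ≠ g * y ∧ z * g ≠ g * z) :
    HasNonCommutingThreeFive G := by
  obtain ⟨T, hTS, hT⟩ := Set.exists_subset_card_eq hS
  have e : T ≃ Fin 5 := Finite.equivFinOfCardEq hT
  refine ⟨![x, y, z], fun j => e.symm j, ?_, Subtype.val_injective.comp e.symm.injective, ?_⟩
  · intro i j hij
    fin_cases i <;> fin_cases j <;> simp_all
  · intro i j
    obtain ⟨h1, h2, h3⟩ := h _ (hTS (e.symm j).2)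
    fin_cases i
    exacts [h1, h2, h3]

/-- The three vertices are `x`, `x⁻¹`, `y`; inverting `x` does not change its centralizer. -/
theorem hasNonCommutingThreeFive_of_ncard_union {x y : G} (hx : x * x ≠ 1) (hxy : y ≠ x)
    (hxy' : y ≠ x⁻¹)
    (h : (((Subgroup.centralizer {x} : Subgroup G) : Set G) ∪
      ((Subgroup.centralizer {y} : Subgroup G) : Set G)).ncard + 5 ≤ Nat.card G) :
    HasNonCommutingThreeFive G := by
  have hx' : x ≠ x⁻¹ := fun h => hx (by nth_rewrite 2 [h]; simp)
  refine hasNonCommutingThreeFive_of_ncard hx' hxy.symm hxy'.symm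
    (S := (((Subgroup.centralizer {x} : Subgroup G) : Set G) ∪
      ((Subgroup.centralizer {y} : Subgroup G) : Set G))ᶜ) ?_ ?_
  · rw [Set.ncard_compl]
    omega
  · intro g hg
    simp only [Set.compl_union, Set.mem_inter_iff, Set.mem_compl_iff, SetLike.mem_coe,
      mem_centralizer_singleton] at hg
    refine ⟨fun h => hg.1 h.symm, fun h => hg.1 ?_, fun h => hg.2 h.symm⟩
    have hc : Commute x⁻¹ g := h
    exact (Commute.inv_left_iff.1 hc).symm

/-- The centralizer has at most a third of the elements, and some conjugate of `x` other than `x`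
and `x⁻¹` serves as `y`, its centralizer being no larger. -/
theorem hasNonCommutingThreeFive_of_index_ne_two {x : G} (hxc : x ∉ Subgroup.center G)
    (hx : x * x ≠ 1) (hG : 10 ≤ Nat.card G) (hindex : (Subgroup.centralizer {x}).index ≠ 2) :
    HasNonCommutingThreeFive G := by
  have hlt : (Subgroup.centralizer {x}).index ≠ 1 := by
    rw [Ne, Subgroup.index_eq_one]
    intro h
    refine hxc (Subgroup.mem_center_iff.2 fun g => mem_centralizer_singleton.1 ?_)
    rw [h]
    trivial
  have hmul := (Subgroup.centralizer {x}).card_mul_index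
  have hpos : (Subgroup.centralizer {x}).index ≠ 0 := Subgroup.FiniteIndex.index_ne_zero
  have hle : Nat.card (Subgroup.centralizer {x}) * 3 ≤ Nat.card G := by
    rw [← hmul]
    exact Nat.mul_le_mul_left _ (by omega)
  -- If every conjugate were `x` or `x⁻¹`, elements outside the centralizer would invert `x`, a
  -- product of two of them would fix it, and the index would be two.
  obtain ⟨g, hg1, hg2⟩ : ∃ g, g * x * g⁻¹ ≠ x ∧ g * x * g⁻¹ ≠ x⁻¹ := by
    by_contra! h
    have hmem : ∀ g, g ∈ Subgroup.centralizer {x} ↔ g * x * g⁻¹ = x := fun g => by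
      rw [mem_centralizer_singleton, mul_inv_eq_iff_eq_mul]
    obtain ⟨a, ha⟩ : ∃ a, a ∉ Subgroup.centralizer {x} := by
      by_contra! h'
      exact hlt (Subgroup.index_eq_one.2 (eq_top_iff.2 fun g _ => h' g))
    have ha' := h a (fun h' => ha ((hmem a).2 h'))
    refine hindex (Subgroup.index_eq_two_iff.2 ⟨a, fun b => ?_⟩)
    by_cases hb : b ∈ Subgroup.centralizer {x}
    · exact Or.inr ⟨hb, fun h' => ha ((Subgroup.mul_mem_cancel_left _ hb).1 h')⟩
    · refine Or.inl ⟨(hmem _).2 ?_, hb⟩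
      have hb' := h b (fun h' => hb ((hmem b).2 h'))
      calc b * a * x * (b * a)⁻¹ = b * (a * x * a⁻¹) * b⁻¹ := by group
        _ = (b * x * b⁻¹)⁻¹ := by rw [ha']; group
        _ = x := by rw [hb', inv_inv]
  refine hasNonCommutingThreeFive_of_ncard_union hx hg1 hg2 ?_
  have hcard : ((Subgroup.centralizer {g * x * g⁻¹} : Subgroup G) : Set G).ncard ≤
      ((Subgroup.centralizer {x} : Subgroup G) : Set G).ncard := by
    refine Set.ncard_le_ncard_of_injOn (fun h => g⁻¹ * h * g) ?_ ?_
    · intro h hh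
      simp only [SetLike.mem_coe, mem_centralizer_singleton] at hh ⊢
      calc g⁻¹ * h * g * x = g⁻¹ * (h * (g * x * g⁻¹)) * g := by group
        _ = x * (g⁻¹ * h * g) := by rw [hh]; group
    · intro h _ h' _ e
      simpa using e
  -- The shared identity saves one element, and the bound is then tight: order 12 with centralizers
  -- of order 4.
  have hinter : 0 < (((Subgroup.centralizer {x} : Subgroup G) : Set G) ∩
      ((Subgroup.centralizer {g * x * g⁻¹} : Subgroup G) : Set G)).ncard := by
    rw [Set.ncard_pos]
    exact ⟨1, one_mem _, one_mem _⟩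
  have hunion := Set.ncard_union_add_ncard_inter
    ((Subgroup.centralizer {x} : Subgroup G) : Set G)
    ((Subgroup.centralizer {g * x * g⁻¹} : Subgroup G) : Set G)
  rw [ncard_coe_subgroup (Subgroup.centralizer {x})] at hcard hunion
  omega

end Group

section Group

variable {G : Type*} [Group G] [Finite G]

omit [Finite G] in
theorem mem_map_subtype_center {H : Subgroup G} {a : G} :
    a ∈ (Subgroup.center H).map H.subtype ↔ a ∈ H ∧ ∀ h ∈ H, h * a = a * h := by
  simp only [Subgroup.mem_map, Subgroup.mem_center_iff, Subgroup.subtype_apply, Subtype.exists,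
    Subtype.forall, MulMemClass.mk_mul_mk, Subtype.mk.injEq]
  constructor
  · rintro ⟨b, hb, h, rfl⟩
    exact ⟨hb, h⟩
  · rintro ⟨ha, h⟩
    exact ⟨a, ha, h, rfl⟩

/-- A group with cyclic quotient by its centre is abelian, so the centre cannot have index two. -/
theorem card_center_ne_of_two_mul {H : Type*} [Group H] [Finite H] :
    Nat.card H ≠ Nat.card (Subgroup.center H) * 2 := by
  intro h
  have hindex : (Subgroup.center H).index = 2 := by
    rw [← (Subgroup.center H).card_mul_index] at h
    exact Nat.eq_of_mul_eq_mul_left Nat.card_pos h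
  have : Fact (Nat.Prime 2) := ⟨Nat.prime_two⟩
  have hc : IsCyclic (H ⧸ Subgroup.center H) := isCyclic_of_prime_card (p := 2) hindex
  have hcomm := ((QuotientGroup.mk' (Subgroup.center H)).isMulCommutative_of_isCyclic_of_ker_le_center
    (by simp)).is_comm.comm
  have htop : Subgroup.center H = ⊤ :=
    eq_top_iff.2 fun a _ => Subgroup.mem_center_iff.2 fun b => hcomm b a
  rw [htop, Subgroup.index_top] at hindex
  omega

omit [Finite G] in
-- The centralizer of `a` contains the index-two subgroup `C(x)`; one more element would make `a`
-- central.
theorem notMem_of_index_two {x a g : G} (hindex : (Subgroup.centralizer {x}).index = 2)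
    (ha : a ∈ (Subgroup.center (Subgroup.centralizer {x})).map
      (Subgroup.centralizer {x}).subtype) (hac : a ∉ Subgroup.center G)
    (hg : g ∉ Subgroup.centralizer {x}) : a * g ≠ g * a := by
  intro h
  rw [mem_map_subtype_center] at ha
  refine hac (Subgroup.mem_center_iff.2 fun k => ?_)
  by_cases hk : k ∈ Subgroup.centralizer {x}
  · exact ha.2 k hk
  · have hgk : g * k ∈ Subgroup.centralizer {x} :=
      (Subgroup.mul_mem_iff_of_index_two hindex).2 (iff_of_false hg hk)
    have h1 := ha.2 _ hgk
    apply mul_left_cancel (a := g)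
    rw [← mul_assoc, h1, ← mul_assoc, ← mul_assoc, h]

/-- Let `H = C(x)` and `K = Z(H)`. Three elements of `K` outside `Z(G)` can be set against the
complement of `H`. Failing that, if `H` has at least 9 elements, `x`, `x⁻¹` and any `y` outside `H`
work, because `H ∪ C(y)` fills at most three quarters of `G`. The remaining orders are impossible.
-/
theorem hasNonCommutingThreeFive_of_index_eq_two {x : G} (hxc : x ∉ Subgroup.center G)
    (hx : x * x ≠ 1) (hG : 10 ≤ Nat.card G) (hindex : (Subgroup.centralizer {x}).index = 2) :
    HasNonCommutingThreeFive G := by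
  set H := Subgroup.centralizer {x} with hH
  set K := (Subgroup.center H).map H.subtype with hK
  have hmul : Nat.card H * 2 = Nat.card G := by rw [← hindex, H.card_mul_index]
  have hxH : x ∈ H := mem_centralizer_singleton.2 rfl
  have hxK : x ∈ K := mem_map_subtype_center.2 ⟨hxH, fun h hh => mem_centralizer_singleton.1 hh⟩
  have hx' : x ≠ x⁻¹ := fun h => hx (by nth_rewrite 2 [h]; simp)
  have hZK : Subgroup.center G ≤ K := fun z hz => by
    have hz' := Subgroup.mem_center_iff.1 hz
    exact mem_map_subtype_center.2 ⟨mem_centralizer_singleton.2 (hz' x).symm, fun h _ => hz' h⟩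
  set T : Set G := (K : Set G) \ Subgroup.center G with hT
  by_cases hT3 : 2 < T.ncard
  · obtain ⟨a, b, c, ha, hb, hc, hab, hac, hbc⟩ := (Set.two_lt_ncard_iff).1 hT3
    refine hasNonCommutingThreeFive_of_ncard hab hac hbc (S := (H : Set G)ᶜ) ?_ ?_
    · rw [Set.ncard_compl, ncard_coe_subgroup]
      omega
    · exact fun g hg => ⟨notMem_of_index_two hindex ha.1 ha.2 hg,
        notMem_of_index_two hindex hb.1 hb.2 hg, notMem_of_index_two hindex hc.1 hc.2 hg⟩
  by_cases hH9 : 9 ≤ Nat.card H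
  · obtain ⟨y, hy⟩ : ∃ y, y ∉ H := by
      by_contra! h
      rw [Subgroup.index_eq_one.2 (eq_top_iff.2 fun g _ => h g)] at hindex
      omega
    refine hasNonCommutingThreeFive_of_ncard_union hx (y := y) (fun h => hy (h ▸ hxH))
      (fun h => hy (h ▸ inv_mem hxH)) ?_
    set C := Subgroup.centralizer {y} with hC
    -- As `H` has index two, multiplication by `y` carries `C(y) \ H` into `H ∩ C(y)`.
    have hdiff : ((C : Set G) \ H).ncard ≤ ((H ⊓ C : Subgroup G) : Set G).ncard := by
      refine Set.ncard_le_ncard_of_injOn (fun g => y * g) ?_ ?_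
      · rintro g ⟨hg1, hg2⟩
        exact ⟨(Subgroup.mul_mem_iff_of_index_two hindex).2 (iff_of_false hy hg2),
          mul_mem (mem_centralizer_singleton.2 rfl) hg1⟩
      · intro h _ h' _ e
        simpa using e
    have hlt : H ⊓ C < H := by
      refine lt_of_le_of_ne inf_le_left fun h => hy ?_
      have hxC : x ∈ C := (h.ge hxH).2
      exact mem_centralizer_singleton.2 (mem_centralizer_singleton.1 hxC).symm
    have hcard : Nat.card (H ⊓ C : Subgroup G) * 2 ≤ Nat.card H := by
      have h1 := Subgroup.card_dvd_of_le hlt.le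
      have h2 : Nat.card (H ⊓ C : Subgroup G) ≠ Nat.card H := fun h =>
        hlt.ne (Subgroup.eq_of_le_of_card_ge hlt.le h.ge)
      obtain ⟨k, hk⟩ := h1
      have hpos : 0 < Nat.card H := Nat.card_pos
      have hk2 : 2 ≤ k := by
        rcases k with _ | _ | k
        · omega
        · omega
        · omega
      rw [hk]
      exact Nat.mul_le_mul_left _ hk2
    have hunion : ((H : Set G) ∪ C).ncard ≤ (H : Set G).ncard + ((C : Set G) \ H).ncard := by
      rw [← Set.union_sdiff_self]
      exact Set.ncard_union_le _ _
    rw [ncard_coe_subgroup] at hunion hdiff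
    change ((H : Set G) ∪ C).ncard + 5 ≤ _
    omega
  -- Here `K \ Z(G)` is just `{x, x⁻¹}`, so `|Z(G)|` divides 2 and `|K|` is 3 or 4. With `5 ≤ |H| ≤
  -- 8` this forces `|H| = 2|K|`, which `card_center_ne_of_two_mul` excludes.
  · exfalso
    have hTpos : 2 ≤ T.ncard := by
      refine (Set.one_lt_ncard_iff).2 ⟨x, x⁻¹, ⟨hxK, hxc⟩, ⟨inv_mem hxK, fun h => hxc ?_⟩, hx'⟩
      simpa using h
    have hTK : T.ncard + Nat.card (Subgroup.center G) = Nat.card K := by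
      have := Set.ncard_sdiff_add_ncard_of_subset (s := (Subgroup.center G : Set G)) (t := K) hZK
      rwa [ncard_coe_subgroup, ncard_coe_subgroup] at this
    have hKH : Nat.card K = Nat.card (Subgroup.center H) :=
      Nat.card_congr (Subgroup.equivMapOfInjective _ _ H.subtype_injective).symm.toEquiv
    have hKdvd : Nat.card K ∣ Nat.card H := hKH ▸ Subgroup.card_subgroup_dvd_card _
    have hZdvd : Nat.card (Subgroup.center G) ∣ Nat.card K := Subgroup.card_dvd_of_le hZK
    have hne : Nat.card H ≠ Nat.card K * 2 := hKH ▸ card_center_ne_of_two_mul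
    have hZ2 : Nat.card (Subgroup.center G) ∣ 2 := by
      have : T.ncard = 2 := by omega
      rw [← hTK, this] at hZdvd
      exact (Nat.dvd_add_left dvd_rfl).1 hZdvd
    have hZ : Nat.card (Subgroup.center G) = 1 ∨ Nat.card (Subgroup.center G) = 2 :=
      (Nat.dvd_prime Nat.prime_two).1 hZ2
    obtain ⟨k, hk⟩ := hKdvd
    rcases hZ with hZ | hZ
    · have : Nat.card K = 3 := by omega
      rw [this] at hk hne
      omega
    · have : Nat.card K = 4 := by omega
      rw [this] at hk hne
      omega

theorem hasNonCommutingThreeFive {a b : G} (hab : a * b ≠ b * a) (hG : 10 ≤ Nat.card G) :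
    HasNonCommutingThreeFive G := by
  obtain ⟨x, hxc, hx⟩ := exists_notMem_center_mul_self_ne_one hab
  by_cases hindex : (Subgroup.centralizer {x}).index = 2
  · exact hasNonCommutingThreeFive_of_index_eq_two hxc hx hG hindex
  · exact hasNonCommutingThreeFive_of_index_ne_two hxc hx hG hindex

end Group

/-! ### Straight-line drawings of planar graphs -/

/-- The image of a drawing under an injective continuous map. -/
def GraphDrawing.map {V X Y : Type*} [TopologicalSpace X] [TopologicalSpace Y]
    {Γ : SimpleGraph V} (D : GraphDrawing Γ X) {f : X → Y} (hf : Continuous f)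
    (hinj : Function.Injective f) : GraphDrawing Γ Y where
  point := f ∘ D.point
  point_injective := hinj.comp D.point_injective
  arc h := (D.arc h).map hf
  arc_symm h := by rw [D.arc_symm, Path.map_symm]
  arc_injective h := hinj.comp (D.arc_injective h)
  arc_ne_point h w t h0 h1 e := D.arc_ne_point h w t h0 h1 (hinj e)
  arc_disjoint h h' he t t' h0 h1 h0' h1' e := D.arc_disjoint h h' he t t' h0 h1 h0' h1' (hinj e)

/-- A drawing of a graph restricts to its subgraphs. -/
def GraphDrawing.comap {V W X : Type*} [TopologicalSpace X] {Γ : SimpleGraph V}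
    {Δ : SimpleGraph W} (D : GraphDrawing Δ X) (φ : Γ →g Δ) (hφ : Function.Injective φ) :
    GraphDrawing Γ X where
  point := D.point ∘ φ
  point_injective := D.point_injective.comp hφ
  arc h := D.arc (φ.map_adj h)
  arc_symm h := D.arc_symm (φ.map_adj h)
  arc_injective _ := D.arc_injective _
  arc_ne_point _ w := D.arc_ne_point _ (φ w)
  arc_disjoint _ _ he := D.arc_disjoint _ _ fun e => he (Sym2.map.injective hφ e)

theorem EmbedsIn.of_hom {V W X : Type*} [TopologicalSpace X] {Γ : SimpleGraph V}
    {Δ : SimpleGraph W} (h : EmbedsIn Δ X) (φ : V → W) (hφ : Function.Injective φ)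
    (hadj : ∀ u v, Γ.Adj u v → Δ.Adj (φ u) (φ v)) : EmbedsIn Γ X :=
  h.map fun D => D.comap ⟨φ, fun {u v} => hadj u v⟩ hφ

theorem exists_continuous_injective_complex_twoSphere :
    ∃ f : ℂ → TwoSphere, Continuous f ∧ Function.Injective f := by
  have : Fact (Module.finrank ℝ (EuclideanSpace ℝ (Fin 3)) = 2 + 1) := ⟨by simp⟩
  let o : TwoSphere := ⟨EuclideanSpace.single 0 1, by simp⟩
  let φ := stereographic' 2 o
  have htarget : φ.target = Set.univ := by simp [φ]
  refine ⟨fun z => φ.symm (Complex.orthonormalBasisOneI.repr z), ?_, ?_⟩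
  · refine Continuous.comp (g := φ.symm) ?_ Complex.orthonormalBasisOneI.repr.continuous
    rw [← continuousOn_univ, ← htarget]
    exact φ.continuousOn_symm
  · intro z w h
    refine Complex.orthonormalBasisOneI.repr.injective (φ.symm.injOn ?_ ?_ h) <;>
      simp [htarget]

theorem EmbedsIn.twoSphere_of_complex {V : Type*} {Γ : SimpleGraph V} (h : EmbedsIn Γ ℂ) :
    EmbedsIn Γ TwoSphere := by
  obtain ⟨f, hf, hinj⟩ := exists_continuous_injective_complex_twoSphere
  exact h.map fun D => D.map hf hinj

/-- Twice the signed area of a triangle in the plane. -/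
def orientation {R : Type*} [CommRing R] (a b c : R × R) : R :=
  (b.1 - a.1) * (c.2 - a.2) - (b.2 - a.2) * (c.1 - a.1)

/-- The points `c` and `d` lie on the same side of the line through `a` and `b`, and not both of
them lie on the line. -/
def SameSide {R : Type*} [CommRing R] [LE R] (a b c d : R × R) : Prop :=
  0 ≤ orientation a b c * orientation a b d ∧ ¬ (orientation a b c = 0 ∧ orientation a b d = 0)

instance (a b c d : ℤ × ℤ) : Decidable (SameSide a b c d) :=
  inferInstanceAs (Decidable (_ ∧ _))

/-- The segment between two points of the plane. -/
noncomputable def segmentPath (a b : ℂ) : Path a b where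
  toFun t := (1 - (t : ℝ) : ℂ) * a + (t : ℝ) * b
  continuous_toFun := by fun_prop
  source' := by simp
  target' := by simp

theorem segmentPath_apply (a b : ℂ) (t : unitInterval) :
    segmentPath a b t = (1 - (t : ℝ) : ℂ) * a + (t : ℝ) * b := rfl

/-- The real coordinates of a complex number. -/
def coords (z : ℂ) : ℝ × ℝ := (z.re, z.im)

theorem orientation_segmentPath (a b c d : ℂ) (t : unitInterval) :
    orientation (coords a) (coords b) (coords (segmentPath c d t)) =
      (1 - t) * orientation (coords a) (coords b) (coords c) +
        t * orientation (coords a) (coords b) (coords d) := by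
  simp [orientation, coords, segmentPath_apply]
  ring

theorem orientation_segmentPath_self (a b : ℂ) (t : unitInterval) :
    orientation (coords a) (coords b) (coords (segmentPath a b t)) = 0 := by
  rw [orientation_segmentPath]
  simp only [orientation]
  ring

theorem segmentPath_injective {a b : ℂ} (h : a ≠ b) : Function.Injective (segmentPath a b) := by
  intro s t hst
  rw [segmentPath_apply, segmentPath_apply] at hst
  have : ((s : ℝ) - (t : ℝ) : ℂ) * (b - a) = 0 := by linear_combination hst
  have := (mul_eq_zero.1 this).resolve_right (sub_ne_zero.2 h.symm)
  exact Subtype.ext (Complex.ofReal_injective (sub_eq_zero.1 this))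

/-- The orientation with respect to `a`, `b` is affine along the segment from `c` to `d`, so it has
no zero inside. One end may lie on the line because edges may share a vertex. -/
theorem SameSide.segmentPath_ne {a b c d : ℂ}
    (h : SameSide (coords a) (coords b) (coords c) (coords d)) (s t : unitInterval)
    (h0 : t ≠ 0) (h1 : t ≠ 1) : segmentPath a b s ≠ segmentPath c d t := by
  intro hst
  have h2 := orientation_segmentPath a b c d t
  rw [← hst, orientation_segmentPath_self] at h2
  obtain ⟨hxy, hne⟩ := h
  generalize orientation (coords a) (coords b) (coords c) = x at *
  generalize orientation (coords a) (coords b) (coords d) = y at *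
  have ht0 : 0 < (t : ℝ) := unitInterval.pos_iff_ne_zero.2 h0
  have ht1 : (t : ℝ) < 1 := unitInterval.lt_one_iff_ne_one.2 h1
  have hy2 : (t : ℝ) * y ^ 2 = -((1 - t) * (x * y)) := by linear_combination -y * h2
  have hy : y = 0 := by
    have : (t : ℝ) * y ^ 2 ≤ 0 := hy2 ▸ neg_nonpos.2 (mul_nonneg (by linarith) hxy)
    have := nonpos_of_mul_nonpos_right this ht0
    exact pow_eq_zero_iff two_ne_zero |>.1 (le_antisymm this (sq_nonneg y))
  subst hy
  have : (1 - (t : ℝ)) * x = 0 := by linarith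
  exact hne ⟨(mul_eq_zero.1 this).resolve_left (by linarith), rfl⟩

/-- A straight-line drawing of a graph in the plane with vertices at lattice points. -/
theorem embedsIn_complex_of_lattice {V : Type*} {Γ : SimpleGraph V} (p : V → ℤ × ℤ)
    (hp : Function.Injective p)
    (hgeneral : ∀ u v w, Γ.Adj u v → w ≠ u → w ≠ v → orientation (p u) (p v) (p w) ≠ 0)
    (hside : ∀ u v u' v', Γ.Adj u v → Γ.Adj u' v' → s(u, v) ≠ s(u', v') →
      SameSide (p u) (p v) (p u') (p v') ∨ SameSide (p u') (p v') (p u) (p v)) :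
    EmbedsIn Γ ℂ := by
  let P : V → ℂ := fun v => ⟨(p v).1, (p v).2⟩
  have hP : Function.Injective P := fun u v h => hp (by simpa [P, Prod.ext_iff] using h)
  have horient : ∀ u v w, orientation (coords (P u)) (coords (P v)) (coords (P w)) =
      ((orientation (p u) (p v) (p w) : ℤ) : ℝ) := by
    intro u v w
    simp [orientation, coords, P]
  have hsame : ∀ u v u' v', SameSide (p u) (p v) (p u') (p v') →
      SameSide (coords (P u)) (coords (P v)) (coords (P u')) (coords (P v')) := by
    intro u v u' v' h
    simp only [SameSide, horient]
    exact_mod_cast h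
  refine ⟨{ point := P
            point_injective := hP
            arc := fun {u v} _ => segmentPath (P u) (P v)
            arc_symm := ?_
            arc_injective := ?_
            arc_ne_point := ?_
            arc_disjoint := ?_ }⟩
  · intro u v h
    ext t
    simp only [Path.symm_apply, Function.comp_apply, segmentPath_apply, unitInterval.coe_symm_eq]
    push_cast
    ring
  · exact fun {u v} h => segmentPath_injective (hP.ne h.ne)
  · intro u v h w t h0 h1 e
    by_cases hwu : w = u
    · subst hwu
      exact h0 (segmentPath_injective (hP.ne h.ne) (by rw [e]; simp))
    by_cases hwv : w = v
    · subst hwv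
      exact h1 (segmentPath_injective (hP.ne h.ne) (by rw [e]; simp))
    have h2 := orientation_segmentPath_self (P u) (P v) t
    rw [e, horient] at h2
    exact hgeneral u v w h hwu hwv (by exact_mod_cast h2)
  · intro u v u' v' h h' he t t' h0 h1 h0' h1'
    rcases hside u v u' v' h h' he with hs | hs
    · exact (hsame _ _ _ _ hs).segmentPath_ne t t' h0' h1'
    · exact ((hsame _ _ _ _ hs).segmentPath_ne t' t h0 h1).symm

/-- The complete graph on five vertices without one edge. -/
def almostCompleteFive : SimpleGraph (Fin 5) where
  Adj u v := u ≠ v ∧ ¬ (3 ≤ u ∧ 3 ≤ v)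
  symm := ⟨fun _ _ h => ⟨h.1.symm, fun h' => h.2 h'.symm⟩⟩
  loopless := ⟨fun _ h => h.1 rfl⟩

instance : DecidableRel almostCompleteFive.Adj := fun _ _ => inferInstanceAs (Decidable (_ ∧ _))

theorem embedsIn_almostCompleteFive : EmbedsIn almostCompleteFive TwoSphere := by
  -- The non-adjacent vertices 3 and 4 lie inside and outside the triangle of the other three.
  refine (embedsIn_complex_of_lattice ![(0, 0), (12, 0), (5, 8), (6, 3), (6, 20)]
    ?_ ?_ ?_).twoSphere_of_complex
  · decide
  · decide
  · decide +kernel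

/-- The graph of the octahedron, with vertices given by an axis and a sign. -/
def octahedronGraph : SimpleGraph (Fin 3 × Bool) where
  Adj u v := u.1 ≠ v.1
  symm := ⟨fun _ _ h => h.symm⟩
  loopless := ⟨fun _ h => h rfl⟩

instance : DecidableRel octahedronGraph.Adj := fun _ _ => inferInstanceAs (Decidable (_ ≠ _))

theorem embedsIn_octahedronGraph : EmbedsIn octahedronGraph TwoSphere := by
  -- A triangle inside a triangle; each inner vertex is placed away from the outer vertex on its
  -- axis.
  refine (embedsIn_complex_of_lattice (fun v => if v.2 then ![(0, 0), (12, 0), (6, 12)] v.1 else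
    ![(9, 4), (3, 4), (5, 1)] v.1) ?_ ?_ ?_).twoSphere_of_complex
  · decide
  · decide
  · decide +kernel

/-! ### Planarity for groups of order less than ten -/

section Group

variable {G : Type*} [Group G] [Finite G]

/-- The identity is central, so there are at most five vertices, and `x`, `x⁻¹` are distinct but not
adjacent. -/
theorem embedsIn_twoSphere_of_card_le_six {a b : G} (hab : a * b ≠ b * a)
    (hG : Nat.card G ≤ 6) : EmbedsIn (nonCommutingGraph G) TwoSphere := by
  obtain ⟨x, hxc, hx⟩ := exists_notMem_center_mul_self_ne_one hab
  have hx' : x ≠ x⁻¹ := fun h => hx (by nth_rewrite 2 [h]; simp)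
  have hxc' : x⁻¹ ∉ Subgroup.center G := by simpa using hxc
  have hcard : Nat.card {x : G // x ∉ Subgroup.center G} ≤ 5 := by
    have : Nat.card {x : G // x ∉ Subgroup.center G} < Nat.card G :=
      Finite.card_subtype_lt (x := 1) (by simp [one_mem])
    omega
  let e : {x : G // x ∉ Subgroup.center G} → Fin 5 := Fin.castLE hcard ∘ Finite.equivFin _
  have he : Function.Injective e := (Fin.castLE_injective hcard).comp (Equiv.injective _)
  have hperm : ∀ i j : Fin 5, i ≠ j → ∃ σ : Equiv.Perm (Fin 5), σ i = 3 ∧ σ j = 4 := by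
    intro i j hij
    refine ⟨Equiv.swap (Equiv.swap i 3 j) 4 * Equiv.swap i 3, ?_⟩
    revert i j
    decide
  obtain ⟨σ, hσ, hσ'⟩ := hperm (e ⟨x, hxc⟩) (e ⟨x⁻¹, hxc'⟩) fun h =>
    hx' (congrArg Subtype.val (he h))
  have hinj : Function.Injective (σ ∘ e) := σ.injective.comp he
  have hlarge : ∀ u, 3 ≤ σ (e u) → u.1 = x ∨ u.1 = x⁻¹ := by
    intro u hu
    have : σ (e u) = 3 ∨ σ (e u) = 4 := by omega
    rcases this with h | h
    · exact Or.inl (congrArg Subtype.val (hinj (h.trans hσ.symm)))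
    · exact Or.inr (congrArg Subtype.val (hinj (h.trans hσ'.symm)))
  refine embedsIn_almostCompleteFive.of_hom (σ ∘ e) hinj fun u v huv =>
    ⟨hinj.ne huv.ne, fun ⟨hu, hv⟩ => huv ?_⟩
  rcases hlarge u hu with h | h <;> rcases hlarge v hv with h' | h' <;> simp [h, h']

/-- The centre is `{1, z}`, so the six vertices form three cosets `{x, z * x}`. Elements of a coset
commute, so the cosets serve as the axes of an octahedron. -/
theorem embedsIn_twoSphere_of_card_eq_eight {a b : G} (hab : a * b ≠ b * a)
    (hG : Nat.card G = 8) : EmbedsIn (nonCommutingGraph G) TwoSphere := by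
  have : Fact (Nat.Prime 2) := ⟨Nat.prime_two⟩
  have : Nontrivial G := Finite.one_lt_card_iff_nontrivial.1 (by omega)
  have hnontriv : Nontrivial (Subgroup.center G) :=
    (IsPGroup.of_card (p := 2) (n := 3) (by rw [hG]; norm_num)).center_nontrivial
  have hZ : Nat.card (Subgroup.center G) = 2 := by
    have h1 : 1 < Nat.card (Subgroup.center G) := Finite.one_lt_card_iff_nontrivial.2 hnontriv
    have h2 : Nat.card G ≠ Nat.card (Subgroup.center G) * 2 := card_center_ne_of_two_mul
    have h3 : Nat.card (Subgroup.center G) ≠ Nat.card G := fun h => by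
      have htop := Subgroup.eq_top_of_card_eq _ h
      exact hab (Subgroup.mem_center_iff.1 (htop ▸ Subgroup.mem_top b : b ∈ Subgroup.center G) a)
    obtain ⟨k, hk⟩ := Subgroup.card_subgroup_dvd_card (Subgroup.center G)
    rw [hG] at h2 h3 hk
    generalize Nat.card (Subgroup.center G) = c at *
    have : c ≤ 8 := Nat.le_of_dvd (by norm_num) ⟨k, hk⟩
    interval_cases c <;> omega
  obtain ⟨⟨z, hz⟩, hz1⟩ := exists_ne (1 : Subgroup.center G)
  replace hz1 : z ≠ 1 := fun h => hz1 (Subtype.ext h)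
  have hzc := Subgroup.mem_center_iff.1 hz
  have hzz : z * z = 1 := by
    have := pow_card_eq_one' (x := (⟨z, hz⟩ : Subgroup.center G))
    rw [hZ, pow_two] at this
    exact congrArg Subtype.val this
  have hcompl : ((Subgroup.center G : Set G)ᶜ).ncard = 6 := by
    rw [Set.ncard_compl, ncard_coe_subgroup, hG, hZ]
  have hexists : ∀ l : List G, l.length < 6 → ∃ x ∉ Subgroup.center G, x ∉ l := by
    classical
    intro l hl
    have h : (l.toFinset : Set G).ncard < ((Subgroup.center G : Set G)ᶜ).ncard := by
      rw [Set.ncard_coe_finset, hcompl]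
      exact (List.toFinset_card_le l).trans_lt hl
    obtain ⟨x, hx, hx'⟩ := Set.exists_mem_notMem_of_ncard_lt_ncard h
    exact ⟨x, hx, by simpa using hx'⟩
  obtain ⟨x₀, hx₀, -⟩ := hexists [] (by simp)
  obtain ⟨x₁, hx₁, h₁⟩ := hexists [x₀, z * x₀] (by simp)
  obtain ⟨x₂, hx₂, h₂⟩ := hexists [x₀, z * x₀, x₁, z * x₁] (by simp)
  simp only [List.mem_cons, List.not_mem_nil, or_false, not_or] at h₁ h₂
  have hflip : ∀ x y, x = z * y → y = z * x := by
    rintro x y rfl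
    rw [← mul_assoc, hzz, one_mul]
  let x : Fin 3 → G := ![x₀, x₁, x₂]
  have hx : ∀ i, x i ∉ Subgroup.center G := by
    intro i
    fin_cases i
    exacts [hx₀, hx₁, hx₂]
  have hxne : ∀ i j, (x i = x j ∨ x i = z * x j) → i = j := by
    have h01 : ¬ (x₀ = x₁ ∨ x₀ = z * x₁) := by grind
    have h02 : ¬ (x₀ = x₂ ∨ x₀ = z * x₂) := by grind
    have h12 : ¬ (x₁ = x₂ ∨ x₁ = z * x₂) := by grind
    have h10 : ¬ (x₁ = x₀ ∨ x₁ = z * x₀) := by grind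
    have h20 : ¬ (x₂ = x₀ ∨ x₂ = z * x₀) := by grind
    have h21 : ¬ (x₂ = x₁ ∨ x₂ = z * x₁) := by grind
    intro i j h
    fin_cases i <;> fin_cases j
    exacts [rfl, absurd h h01, absurd h h02, absurd h h10, rfl, absurd h h12, absurd h h20,
      absurd h h21, rfl]
  let ψ : Fin 3 × Bool → {x : G // x ∉ Subgroup.center G} := fun v =>
    if v.2 then ⟨z * x v.1, fun h => hx v.1 ((Subgroup.mul_mem_cancel_left _ hz).1 h)⟩
    else ⟨x v.1, hx v.1⟩
  have hψ : Function.Injective ψ := by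
    rintro ⟨i, _ | _⟩ ⟨j, _ | _⟩ h
    all_goals
      replace h := congrArg Subtype.val h
      simp only [ψ, Bool.false_eq_true, if_true, if_false] at h
    · rw [hxne i j (Or.inl h)]
    · obtain rfl := hxne i j (Or.inr h)
      exact absurd (right_eq_mul.1 h) hz1
    · obtain rfl := hxne j i (Or.inr h.symm)
      exact absurd (mul_eq_right.1 h) hz1
    · rw [hxne i j (Or.inl (mul_left_cancel h))]
  have hbij : Function.Bijective ψ := by
    refine (Nat.bijective_iff_injective_and_card ψ).2 ⟨hψ, ?_⟩
    have : Nat.card {x : G // x ∉ Subgroup.center G} = 6 := hcompl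
    rw [this]
    simp
  let e := Equiv.ofBijective ψ hbij
  refine embedsIn_octahedronGraph.of_hom e.symm e.symm.injective fun u v huv => ?_
  obtain ⟨⟨i, s⟩, rfl⟩ := e.surjective u
  obtain ⟨⟨j, t⟩, rfl⟩ := e.surjective v
  rw [Equiv.symm_apply_apply, Equiv.symm_apply_apply]
  rintro rfl
  apply huv
  have hcomm : x i * (z * x i) = z * (x i * x i) := by rw [← mul_assoc, hzc, mul_assoc]
  cases s <;> cases t <;> simp [e, ψ, mul_assoc, hcomm]

theorem embedsIn_twoSphere_of_card_lt_ten {a b : G} (hab : a * b ≠ b * a)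
    (hG : Nat.card G < 10) : EmbedsIn (nonCommutingGraph G) TwoSphere := by
  by_cases h6 : Nat.card G ≤ 6
  · exact embedsIn_twoSphere_of_card_le_six hab h6
  have : Nat.card G = 7 ∨ Nat.card G = 8 ∨ Nat.card G = 9 := by omega
  rcases this with h | h | h
  · have : Fact (Nat.Prime 7) := ⟨by norm_num⟩
    have := isCyclic_of_prime_card h
    exact absurd (IsCyclic.isMulCommutative.is_comm.comm a b) hab
  · exact embedsIn_twoSphere_of_card_eq_eight hab h
  · have : Fact (Nat.Prime 3) := ⟨by norm_num⟩
    have := IsPGroup.isMulCommutative_of_card_eq_prime_sq (p := 3) (G := G) (by rw [h]; norm_num)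
    exact absurd (this.is_comm.comm a b) hab

end Group

theorem mainTheorem4 (G : Type*) [Group G] [Finite G] (hG : ∃ a b : G, a * b ≠ b * a) :
    ¬ IsProjectiveGraph (nonCommutingGraph G) := by
  obtain ⟨a, b, hab⟩ := hG
  rintro ⟨hproj, hsphere⟩
  by_cases h : Nat.card G < 10
  · exact hsphere (embedsIn_twoSphere_of_card_lt_ten hab h)
  · exact (hasNonCommutingThreeFive hab (not_lt.1 h)).not_embedsIn hproj
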